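/- Conventions. A gauge is a non-decreasing, right-continuous function $\phi\colon[0,\infty)\to[0,\infty)$ with $\phi(0)=0$ and $\phi(r)>0$ for $r>0$. For a metric space $X$, $\mathscr H^\phi_X$ is the Hausdorff (outer) measure $\mathscr H^\phi_X(E)=\sup_{\delta>0}\inf\{\sum_n\phi(\operatorname{diam}E_n):\{E_n\}\text{ a countable cover of }E,\ \operatorname{diam}E_n<\delta\text{ for all }n\}$, and $\mathcal N(\mathscr H^\phi_X)=\{E\subseteq X:\mathscr H^\phi_X(E)=0\}$. For a sequence $s=\langle s_n:n\ge1\rangle$ of positive reals strictly decreasing to $0$, $\mathcal D_X(s^*)$ is the family of all $E\subseteq X$ such that for every integer $k\ge1$ there is a cover $\langle E_n:n\ge1\rangle$ of $E$ by subsets of $X$ with $\operatorname{diam}E_n<s_{kn}$ for all $n\ge1$. Write $\phi\asymp s$ if there are $a,b>0$ with $a\le n\,\phi(s_n)\le b$ for all but finitely many $n$. For $L>0$, $\phi$ is $L$-doubling if there is $R>0$ with $\phi(2r)\le L\phi(r)$ for all $r\in(0,R]$. Theorem. Let $s$ be a sequence of positive reals strictly decreasing to $0$ and let $\phi$ be a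 gauge with $\phi\asymp s$. Then: (i) $\mathcal N(\mathscr H^\phi_{\ell^2})\subsetneqq\mathcal D_{\ell^2}(s^*)\subsetneqq\bigcap_{\alpha>1}\mathcal N(\mathscr H^{\phi^\alpha}_{\ell^2})$, where $\ell^2$ is the real Hilbert space of square-summable sequences. (ii) If $\phi$ is $L$-doubling for some $0<L<2$, then $\mathcal N(\mathscr H^\phi_{\mathbb R})\subsetneqq\mathcal D_{\mathbb R}(s^*)\subsetneqq\bigcap_{\alpha>1}\mathcal N(\mathscr H^{\phi^\alpha}_{\mathbb R})$. -/

import Mathlib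

open Set Filter Topology
open scoped NNReal ENNReal

namespace DominatedSets

/-- A gauge: a non-decreasing, right-continuous function `φ : [0, ∞) → [0, ∞)` with `φ 0 = 0`
and `φ r > 0` for `r > 0`. -/
structure IsGauge (φ : ℝ≥0 → ℝ≥0) : Prop where
  mono : Monotone φ
  right_continuous : ∀ r, ContinuousWithinAt φ (Ici r) r
  map_zero : φ 0 = 0
  pos : ∀ r, 0 < r → 0 < φ r

/-- `φ` is `L`-doubling: `φ (2 r) ≤ L φ r` for all sufficiently small `r > 0`. -/
def IsDoublingWith (L : ℝ≥0) (φ : ℝ≥0 → ℝ≥0) : Prop :=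
  ∃ R : ℝ≥0, 0 < R ∧ ∀ r, 0 < r → r ≤ R → φ (2 * r) ≤ L * φ r

/-- The family of all strictly decreasing sequences of positive reals converging to `0`,
indexed by the positive integers. -/
def nullSequences : Set (ℕ+ → ℝ≥0) :=
  {s | StrictAnti s ∧ (∀ n, 0 < s n) ∧ Tendsto s atTop (𝓝 0)}

/-- The multiplicative `k`-shift `n ↦ s (k n)` of the sequence `s`. -/
def multShift (k : ℕ+) (s : ℕ+ → ℝ≥0) : ℕ+ → ℝ≥0 := fun n => s (k * n)

/-- The closure `s*` of a sequence: the set of all its multiplicative shifts. -/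
def multClosure (s : ℕ+ → ℝ≥0) : Set (ℕ+ → ℝ≥0) := {t | ∃ k : ℕ+, t = multShift k s}

/-- `φ ≍ s`: there are `a, b > 0` with `a ≤ n φ(s n) ≤ b` for all but finitely many `n`. -/
def Comparable (φ : ℝ≥0 → ℝ≥0) (s : ℕ+ → ℝ≥0) : Prop :=
  ∃ a b : ℝ≥0, 0 < a ∧ 0 < b ∧
    ∀ᶠ n : ℕ+ in atTop, a ≤ ((n : ℕ) : ℝ≥0) * φ (s n) ∧ ((n : ℕ) : ℝ≥0) * φ (s n) ≤ b

/-- A sequence of sets is `s`-fine if `diam (A n) < s n` for all `n`. The diameter takes values in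
`[0, ∞]`, so unbounded sets are never allowed. -/
def IsFine {X : Type*} [MetricSpace X] (s : ℕ+ → ℝ≥0) (A : ℕ+ → Set X) : Prop :=
  ∀ n, Metric.ediam (A n) < (s n : ℝ≥0∞)

/-- `D_X(S)`: the family of all `S`-dominated subsets of `X`, that is, of those `E` that have
an `s`-fine cover for each `s ∈ S`. -/
def dominatedSets (X : Type*) [MetricSpace X] (S : Set (ℕ+ → ℝ≥0)) : Set (Set X) :=
  {E | ∀ s ∈ S, ∃ A : ℕ+ → Set X, IsFine s A ∧ E ⊆ ⋃ n, A n}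

/-- The `φ`-dimensional Hausdorff (outer) measure `H^φ`. The value given to sets of infinite
diameter is immaterial, as only covers by sets of small diameter matter; see
`hausdorffGauge_apply` for the formula. -/
noncomputable def hausdorffGauge (X : Type*) [MetricSpace X] (φ : ℝ≥0 → ℝ≥0) :
    MeasureTheory.OuterMeasure X :=
  MeasureTheory.OuterMeasure.mkMetric fun d => (φ d.toNNReal : ℝ≥0∞)

/-- `H^φ(E)` is the supremum over `δ > 0` of the infima of `∑ φ(diam (A n))` over
all countable covers of `E` by sets of diameter less than `δ`. -/
theorem hausdorffGauge_apply {X : Type*} [MetricSpace X] {φ : ℝ≥0 → ℝ≥0} (hφ : IsGauge φ)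
    (E : Set X) :
    hausdorffGauge X φ E =
      ⨆ (δ : ℝ≥0) (_ : 0 < δ), ⨅ (A : ℕ → Set X) (_ : E ⊆ ⋃ n, A n)
        (_ : ∀ n, Metric.ediam (A n) < (δ : ℝ≥0∞)),
          ∑' n, (φ (Metric.ediam (A n)).toNNReal : ℝ≥0∞) := by
  let _ : MeasurableSpace X := borel X
  have _ : BorelSpace X := ⟨rfl⟩
  have key : ∀ A : Set X, (⨆ _ : A.Nonempty, (φ (Metric.ediam A).toNNReal : ℝ≥0∞)) =
      (φ (Metric.ediam A).toNNReal : ℝ≥0∞) := by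
    intro A
    rcases A.eq_empty_or_nonempty with rfl | h
    · simp [hφ.map_zero]
    · simp [h]
  rw [hausdorffGauge, MeasureTheory.OuterMeasure.coe_mkMetric,
    MeasureTheory.Measure.mkMetric_apply]
  simp only [key]
  apply le_antisymm
  · refine iSup₂_le fun r hr => ?_
    obtain ⟨δ, hδ, hδr⟩ := ENNReal.lt_iff_exists_nnreal_btwn.1 hr
    refine le_trans ?_ (le_iSup₂ (f := fun (δ : ℝ≥0) (_ : 0 < δ) =>
      ⨅ (A : ℕ → Set X) (_ : E ⊆ ⋃ n, A n) (_ : ∀ n, Metric.ediam (A n) < (δ : ℝ≥0∞)),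
          ∑' n, (φ (Metric.ediam (A n)).toNNReal : ℝ≥0∞)) δ (by exact_mod_cast hδ))
    exact le_iInf fun A => le_iInf fun hA => le_iInf fun hd =>
      iInf_le_of_le A (iInf_le_of_le hA
        (iInf_le_of_le (fun n => ((hd n).trans hδr).le) le_rfl))
  · refine iSup₂_le fun δ hδ => ?_
    have h2 : (0 : ℝ≥0∞) < ((δ / 2 : ℝ≥0) : ℝ≥0∞) := by exact_mod_cast half_pos hδ
    have h3 : ((δ / 2 : ℝ≥0) : ℝ≥0∞) < (δ : ℝ≥0∞) := by exact_mod_cast NNReal.half_lt_self hδ.ne'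
    refine le_trans ?_ (le_iSup₂ (f := fun (r : ℝ≥0∞) (_ : 0 < r) =>
      ⨅ (A : ℕ → Set X) (_ : E ⊆ ⋃ n, A n) (_ : ∀ n, Metric.ediam (A n) ≤ r),
          ∑' n, (φ (Metric.ediam (A n)).toNNReal : ℝ≥0∞)) _ h2)
    exact le_iInf fun A => le_iInf fun hA => le_iInf fun hd =>
      iInf_le_of_le A (iInf_le_of_le hA
        (iInf_le_of_le (fun n => (hd n).trans_lt h3) le_rfl))

/-- `N(H^φ)`: the family of all subsets of `X` of `φ`-dimensional Hausdorff measure zero. -/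
def nullSets (X : Type*) [MetricSpace X] (φ : ℝ≥0 → ℝ≥0) : Set (Set X) :=
  {E | hausdorffGauge X φ E = 0}

/-- The power `φ^α` of a gauge. -/
noncomputable def gaugePow (φ : ℝ≥0 → ℝ≥0) (α : ℝ) : ℝ≥0 → ℝ≥0 := fun r => φ r ^ α

/-- The real Hilbert space of square-summable sequences indexed by the positive integers. -/
abbrev EllTwo : Type := lp (fun _ : ℕ+ => ℝ) 2

end DominatedSets

/-! If `∑ φ (diam A)` is small along a cover, ranking its sets by decreasing `φ (diam A)` makes
`n φ (diam A)` small for the `n`-th set, so `φ ≍ s` forces `diam A < s (k n)`. Conversely, if the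
`n`-th set has diameter less than `s (k n)`, then `∑ φ (diam A) ^ α ≤ (b / k) ^ α ∑ n ^ (-α)`, which
tends to `0` as `k → ∞`.

The inclusions are strict because of images of `[0, 1)` under maps `f` that separate two points by
about `s (n j)` when their `q`-adic expansions first differ at the `j`-th digit, and Lebesgue
measure serves as a mass distribution. For `n j` of order `q ^ j` the set is dominated but not
`H^φ`-null. For `n j` of order `q ^ j / (j + 1) ^ 2` it is null for every `φ ^ α` with `α > 1`,
but it is not dominated, since `∑ n (j + 1) q ^ (-j) < ∞`. In `ℓ²` such an `f` maps expansions to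
branches of a tree with orthogonal edges. In `ℝ` it is a Cantor-type series in the digits, and
`L`-doubling with `L < 2` makes `s (n j)` decay fast enough for the series to separate points. -/

namespace DominatedSets

theorem injective_ncard_preimage_Iic {ι β : Type*} [LinearOrder β] {f : ι → β}
    (hf : Function.Injective f) (hfin : ∀ i, (f ⁻¹' Iic (f i)).Finite) :
    Function.Injective fun i => (f ⁻¹' Iic (f i)).ncard := by
  have hlt : ∀ {i j}, f i < f j → (f ⁻¹' Iic (f i)).ncard < (f ⁻¹' Iic (f j)).ncard :=
    fun {_ j} hij => ncard_lt_ncard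
      ⟨preimage_mono (Iic_subset_Iic.2 hij.le), fun hsub => hij.not_ge (@hsub j le_rfl)⟩ (hfin j)
  intro i j hij
  rcases lt_trichotomy (f i) (f j) with h | h | h
  · exact absurd hij (hlt h).ne
  · exact hf h
  · exact absurd hij (hlt h).ne'

theorem exists_injective_mul_le_tsum {ι : Type*} {w : ι → ℝ≥0∞} (hw : ∀ i, w i ≠ 0)
    (hsum : ∑' i, w i ≠ ∞) :
    ∃ g : ι → ℕ+, Function.Injective g ∧ ∀ i, ((g i : ℕ) : ℝ≥0∞) * w i ≤ ∑' j, w j := by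
  obtain ⟨_, -⟩ := exists_wellFoundedLT ι
  -- Rank the indices by decreasing weight, ties being broken by the order of `ι`.
  let key : ι → ℝ≥0∞ᵒᵈ ×ₗ ι := fun i => toLex (OrderDual.toDual (w i), i)
  have hkey : Function.Injective key := fun i j hij =>
    congrArg Prod.snd (toLex.injective hij)
  have hle : ∀ i, ∀ j ∈ key ⁻¹' Iic (key i), w i ≤ w j := fun i j hj =>
    Prod.Lex.monotone_fst _ _ hj
  have hfin : ∀ i, (key ⁻¹' Iic (key i)).Finite := fun i =>
    (ENNReal.finite_const_le_of_tsum_ne_top hsum (hw i)).subset (hle i)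
  have hpos : ∀ i, 0 < (key ⁻¹' Iic (key i)).ncard := fun i =>
    (ncard_pos (hfin i)).2 ⟨i, mem_preimage.2 (mem_Iic.2 le_rfl)⟩
  refine ⟨fun i => ⟨_, hpos i⟩, fun i j hij =>
    injective_ncard_preimage_Iic hkey hfin (congrArg PNat.val hij), fun i => ?_⟩
  calc ((key ⁻¹' Iic (key i)).ncard : ℝ≥0∞) * w i
      = (hfin i).toFinset.card • w i := by
        rw [nsmul_eq_mul, ncard_eq_toFinset_card _ (hfin i)]
    _ ≤ ∑ j ∈ (hfin i).toFinset, w j :=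
        Finset.card_nsmul_le_sum _ _ _ fun j hj => hle i j ((hfin i).mem_toFinset.1 hj)
    _ ≤ ∑' j, w j := ENNReal.sum_le_tsum _

section Inclusions

variable {X : Type*} [MetricSpace X] {φ : ℝ≥0 → ℝ≥0} {s : ℕ+ → ℝ≥0}

theorem IsGauge.gaugePow (hφ : IsGauge φ) {α : ℝ} (hα : 0 < α) : IsGauge (gaugePow φ α) where
  mono _ _ h := NNReal.rpow_le_rpow (hφ.mono h) hα.le
  right_continuous r :=
    (NNReal.continuous_rpow_const hα.le).continuousAt.comp_continuousWithinAt
      (hφ.right_continuous r)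
  map_zero := by simp only [DominatedSets.gaugePow, hφ.map_zero, NNReal.zero_rpow hα.ne']
  pos r hr := NNReal.rpow_pos (hφ.pos r hr)

theorem IsGauge.apply_ediam_le (hφ : IsGauge φ) {A : Set X} {r : ℝ≥0}
    (hA : Metric.ediam A ≤ r) : φ (Metric.ediam A).toNNReal ≤ φ r :=
  hφ.mono (ENNReal.toNNReal_mono ENNReal.coe_ne_top hA)

theorem Comparable.exists_forall (h : Comparable φ s) (hφ : IsGauge φ) (hs : s ∈ nullSequences) :
    ∃ a b : ℝ≥0, 0 < a ∧ (∀ n : ℕ+, a ≤ (n : ℕ) * φ (s n)) ∧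
      ∀ n : ℕ+, (n : ℕ) * φ (s n) ≤ b := by
  obtain ⟨a, b, ha, -, hab⟩ := h
  obtain ⟨N, hN⟩ := eventually_atTop.1 hab
  refine ⟨min a (φ (s N)), max b ((N : ℕ) * φ (s 1)), lt_min ha (hφ.pos _ (hs.2.1 N)),
    fun n => ?_, fun n => ?_⟩ <;> rcases le_total N n with hn | hn
  · exact (min_le_left _ _).trans (hN n hn).1
  · calc min a (φ (s N)) ≤ φ (s N) := min_le_right _ _
      _ ≤ φ (s n) := hφ.mono (hs.1.antitone hn)
      _ ≤ (n : ℕ) * φ (s n) := le_mul_of_one_le_left zero_le (by exact_mod_cast n.pos)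
  · exact (hN n hn).2.trans (le_max_left _ _)
  · calc (n : ℕ) * φ (s n) ≤ (N : ℕ) * φ (s 1) :=
          mul_le_mul' (by exact_mod_cast hn) (hφ.mono (hs.1.antitone one_le))
      _ ≤ _ := le_max_right _ _

theorem mem_nullSets_iff (hφ : IsGauge φ) {E : Set X} :
    E ∈ nullSets X φ ↔ ∀ δ : ℝ≥0, 0 < δ → ∀ ε : ℝ≥0∞, 0 < ε → ∃ A : ℕ → Set X,
      E ⊆ ⋃ n, A n ∧ (∀ n, Metric.ediam (A n) < δ) ∧
        ∑' n, (φ (Metric.ediam (A n)).toNNReal : ℝ≥0∞) < ε := by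
  change hausdorffGauge X φ E = 0 ↔ _
  simp only [hausdorffGauge_apply hφ, ← nonpos_iff_eq_zero (α := ℝ≥0∞), iSup₂_le_iff]
  refine forall₂_congr fun δ _ => ?_
  rw [← forall_gt_iff_le]
  simp only [iInf_lt_iff, exists_prop]

theorem mem_nullSets_of_tendsto (hφ : IsGauge φ) {E : Set X} {u : ℕ → ℝ≥0∞}
    (hu : Tendsto u atTop (𝓝 0)) {r : ℕ → ℝ≥0} (hr : Tendsto r atTop (𝓝 0))
    (h : ∀ k, ∃ A : ℕ → Set X, E ⊆ ⋃ n, A n ∧ (∀ n, Metric.ediam (A n) ≤ r k) ∧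
      ∑' n, (φ (Metric.ediam (A n)).toNNReal : ℝ≥0∞) ≤ u k) :
    E ∈ nullSets X φ := by
  refine (mem_nullSets_iff hφ).2 fun δ hδ ε hε => ?_
  obtain ⟨k, hkδ, hkε⟩ := ((hr.eventually_lt_const hδ).and (hu.eventually_lt_const hε)).exists
  obtain ⟨A, hEA, hdiam, hsum⟩ := h k
  exact ⟨A, hEA, fun n => (hdiam n).trans_lt (ENNReal.coe_lt_coe.2 hkδ), hsum.trans_lt hkε⟩

theorem exists_isFine_iUnion_subset {ι : Type*} (hs : ∀ n, 0 < s n) {g : ι → ℕ+}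
    (hg : Function.Injective g) {A : ι → Set X} (hA : ∀ i, Metric.ediam (A i) < s (g i)) :
    ∃ B : ℕ+ → Set X, IsFine s B ∧ ⋃ i, A i ⊆ ⋃ n, B n := by
  refine ⟨Function.extend g A fun _ => ∅, fun n => ?_, iUnion_subset fun i => ?_⟩
  · by_cases hn : ∃ i, g i = n
    · obtain ⟨i, rfl⟩ := hn
      simpa only [hg.extend_apply] using hA i
    · simpa only [Function.extend_apply' _ _ _ hn, Metric.ediam_empty, ENNReal.coe_pos] using hs n
  · exact subset_iUnion_of_subset (g i) (hg.extend_apply A _ i).ge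

theorem nullSets_subset_dominatedSets (hφ : IsGauge φ) (hs : ∀ n, 0 < s n) {a : ℝ≥0}
    (ha : 0 < a) (has : ∀ n : ℕ+, a ≤ (n : ℕ) * φ (s n)) :
    nullSets X φ ⊆ dominatedSets X (multClosure s) := by
  rintro E hE _ ⟨k, rfl⟩
  have hk : ((k : ℕ) : ℝ≥0) ≠ 0 := Nat.cast_ne_zero.2 k.ne_zero
  have hε : (0 : ℝ≥0∞) < (a / (k : ℕ) : ℝ≥0) :=
    ENNReal.coe_pos.2 (div_pos ha (pos_of_ne_zero hk))
  obtain ⟨A, hEA, hdiam, hsum⟩ := (mem_nullSets_iff hφ).1 hE 1 one_pos _ (ENNReal.half_pos hε.ne')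
  obtain ⟨η, hη, hηsum⟩ := ENNReal.exists_pos_sum_of_countable' (ENNReal.half_pos hε.ne').ne' ℕ
  -- Sets of diameter `0` may occur infinitely often; the perturbation `η` makes them sortable.
  let w : ℕ → ℝ≥0∞ := fun n => φ (Metric.ediam (A n)).toNNReal + η n
  have hw : ∑' n, w n < (a / (k : ℕ) : ℝ≥0) := by
    rw [ENNReal.tsum_add, ← ENNReal.add_halves ((a / (k : ℕ) : ℝ≥0) : ℝ≥0∞)]
    exact ENNReal.add_lt_add hsum hηsum
  obtain ⟨g, hg, hgw⟩ := exists_injective_mul_le_tsum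
    (fun n => ((hη n).trans_le le_add_self).ne') (hw.trans ENNReal.coe_lt_top).ne
  suffices hfine : ∀ n, Metric.ediam (A n) < multShift k s (g n) by
    obtain ⟨B, hB, hAB⟩ := exists_isFine_iUnion_subset (fun n => hs (k * n)) hg hfine
    exact ⟨B, hB, hEA.trans hAB⟩
  intro n
  rw [← ENNReal.coe_toNNReal ((hdiam n).trans ENNReal.coe_lt_top).ne, ENNReal.coe_lt_coe]
  refine hφ.mono.reflect_lt (lt_of_mul_lt_mul_left ?_ (zero_le (a := (((k * g n : ℕ+) : ℕ) : ℝ≥0))))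
  have hsmall : (g n : ℕ) * φ (Metric.ediam (A n)).toNNReal < a / (k : ℕ) := by
    exact_mod_cast (mul_le_mul_right le_self_add _).trans_lt ((hgw n).trans_lt hw)
  calc (k * g n : ℕ+) * φ (Metric.ediam (A n)).toNNReal
      = (k : ℕ) * ((g n : ℕ) * φ (Metric.ediam (A n)).toNNReal) := by push_cast; ring
    _ < a := by rwa [mul_comm, ← lt_div_iff₀ (by positivity)]
    _ ≤ (k * g n : ℕ+) * φ (multShift k s (g n)) := has _

theorem dominatedSets_subset_nullSets (hφ : IsGauge φ) (hs : s ∈ nullSequences) {b : ℝ≥0}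
    (hbs : ∀ n : ℕ+, (n : ℕ) * φ (s n) ≤ b) {α : ℝ} (hα : 1 < α) :
    dominatedSets X (multClosure s) ⊆ nullSets X (gaugePow φ α) := by
  intro E hE
  have hα0 : 0 < α := one_pos.trans hα
  let C : ℝ≥0∞ := ∑' n : ℕ, (((b / (n + 1 : ℕ)) ^ α : ℝ≥0) : ℝ≥0∞)
  have hC : C ≠ ∞ := by
    have hsummable : Summable fun n : ℕ => (((n + 1 : ℕ) : ℝ≥0) ^ α)⁻¹ :=
      (NNReal.summable_nat_add_iff 1).2 (NNReal.summable_rpow_inv.2 hα)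
    refine ENNReal.tsum_coe_ne_top_iff_summable.2 ?_
    simpa only [NNReal.div_rpow, div_eq_mul_inv (b ^ α)] using hsummable.mul_left (b ^ α)
  have hpow : Tendsto (fun k : ℕ => (((k + 1 : ℕ) : ℝ≥0)⁻¹) ^ α) atTop (𝓝 0) := by
    simpa only [NNReal.zero_rpow hα0.ne', Function.comp_def] using
      ((tendsto_inv_atTop_nhds_zero_nat (𝕜 := ℝ≥0)).comp (tendsto_add_atTop_nat 1)).nnrpow
        (tendsto_const_nhds (x := α)) (Or.inr hα0)
  have hu : Tendsto (fun k : ℕ => (((((k + 1 : ℕ) : ℝ≥0)⁻¹) ^ α : ℝ≥0) : ℝ≥0∞) * C)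
      atTop (𝓝 0) := by
    simpa only [ENNReal.coe_zero, zero_mul] using
      ENNReal.Tendsto.mul_const (ENNReal.tendsto_coe.2 hpow) (Or.inr hC)
  have hr : Tendsto (fun k : ℕ => s k.succPNat) atTop (𝓝 0) :=
    hs.2.2.comp (tendsto_atTop_atTop.2 fun n => ⟨n, fun k hk =>
      PNat.coe_le_coe _ _ |>.1 (hk.trans k.le_succ)⟩)
  refine mem_nullSets_of_tendsto (hφ.gaugePow hα0) hu hr fun k => ?_
  obtain ⟨A, hA, hEA⟩ := hE _ ⟨k.succPNat, rfl⟩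
  refine ⟨fun n => A n.succPNat, ?_, fun n => ?_, ?_⟩
  · change E ⊆ ⋃ n, A (Equiv.pnatEquivNat.symm n)
    rwa [Equiv.pnatEquivNat.symm.surjective.iUnion_comp A]
  · refine (hA _).le.trans (ENNReal.coe_le_coe.2 (hs.1.antitone ?_))
    exact le_mul_of_one_le_right' one_le
  · rw [← ENNReal.tsum_mul_left]
    refine ENNReal.tsum_le_tsum fun n => ?_
    rw [← ENNReal.coe_mul, ENNReal.coe_le_coe, ← NNReal.mul_rpow]
    refine NNReal.rpow_le_rpow ((hφ.apply_ediam_le (hA n.succPNat).le).trans ?_) hα0.le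
    have hbound := hbs (k.succPNat * n.succPNat)
    rw [inv_mul_eq_div, div_div, le_div_iff₀' (by positivity)]
    simpa only [multShift, PNat.mul_coe, Nat.succPNat_coe, Nat.cast_mul, mul_comm] using hbound

end Inclusions

theorem mul_tsum_ite_mul_lt_le (k N : ℕ+) (c : ℝ≥0∞) :
    ((k : ℕ) : ℝ≥0∞) * ∑' m : ℕ+, (if k * m < N then c else 0) ≤ (N : ℕ) * c := by
  let F : Finset ℕ+ := (Finset.range (N / k : ℕ)).map ⟨Nat.succPNat, Nat.succPNat_injective⟩
  have hF : ∀ m ∉ F, (if k * m < N then c else 0) = 0 := fun m hm => if_neg fun hlt => hm <| by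
    refine Finset.mem_map.2 ⟨m.natPred, Finset.mem_range.2 ?_, PNat.succPNat_natPred m⟩
    rw [← Nat.succ_le_iff, Nat.succ_eq_add_one, PNat.natPred_add_one,
      Nat.le_div_iff_mul_le k.pos, mul_comm]
    exact PNat.coe_le_coe _ _ |>.2 hlt.le
  calc ((k : ℕ) : ℝ≥0∞) * ∑' m : ℕ+, (if k * m < N then c else 0)
      = (k : ℕ) * ∑ m ∈ F, (if k * m < N then c else 0) := by rw [tsum_eq_sum hF]
    _ ≤ (k : ℕ) * ∑ _m ∈ F, c := by
        gcongr
        split_ifs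
        exacts [le_rfl, zero_le]
    _ = ((k * (N / k) : ℕ) : ℝ≥0∞) * c := by
        rw [Finset.sum_const, Finset.card_map, Finset.card_range, nsmul_eq_mul, Nat.cast_mul,
          mul_assoc]
    _ ≤ (N : ℕ) * c := by
        gcongr
        exact Nat.mul_div_le _ _

open MeasureTheory

/-- The index `m` of the `q`-adic interval `[m q⁻ʲ, (m + 1) q⁻ʲ)` that contains the point
`x ≥ 0`. -/
noncomputable def adicIndex (q j : ℕ) (x : ℝ) : ℕ := ⌊(q : ℝ) ^ j * x⌋₊

section AdicIndex

variable {q : ℕ}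

theorem adicIndex_zero {x : ℝ} (hx : x ∈ Ico (0 : ℝ) 1) : adicIndex q 0 x = 0 := by
  rw [adicIndex, pow_zero, one_mul, Nat.floor_eq_zero]
  exact hx.2

theorem adicIndex_add_div_pow (hq : 0 < q) (i k : ℕ) (x : ℝ) :
    adicIndex q (i + k) x / q ^ k = adicIndex q i x := by
  rw [adicIndex, ← Nat.floor_div_natCast, Nat.cast_pow, pow_add, mul_right_comm,
    mul_div_cancel_right₀ _ (by positivity), adicIndex]

theorem adicIndex_eq_of_le (hq : 0 < q) {i j : ℕ} (hij : i ≤ j) {x y : ℝ}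
    (h : adicIndex q j x = adicIndex q j y) : adicIndex q i x = adicIndex q i y := by
  obtain ⟨k, rfl⟩ := Nat.exists_eq_add_of_le hij
  rw [← adicIndex_add_div_pow hq i k x, h, adicIndex_add_div_pow hq]

theorem adicIndex_lt (hq : 0 < q) (j : ℕ) {x : ℝ} (hx : x ∈ Ico (0 : ℝ) 1) :
    adicIndex q j x < q ^ j := by
  rw [adicIndex, Nat.floor_lt (mul_nonneg (by positivity) hx.1), Nat.cast_pow]
  exact mul_lt_of_lt_one_right (by positivity) hx.2

theorem eq_of_forall_adicIndex_eq (hq : 2 ≤ q) {x y : ℝ} (hx : 0 ≤ x) (hy : 0 ≤ y)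
    (h : ∀ j, adicIndex q j x = adicIndex q j y) : x = y := by
  by_contra hxy
  obtain ⟨j, hj⟩ := pow_unbounded_of_one_lt |x - y|⁻¹ (show (1 : ℝ) < q by exact_mod_cast hq)
  have hlt : |(q : ℝ) ^ j * x - (q : ℝ) ^ j * y| < 1 := by
    have hx' := (Nat.floor_eq_iff (mul_nonneg (by positivity) hx)).1 (h j)
    have hy' := (Nat.floor_eq_iff (mul_nonneg (by positivity) hy)).1 (rfl : adicIndex q j y = _)
    rw [abs_sub_lt_iff]
    constructor <;> linarith [hx'.1, hx'.2, hy'.1, hy'.2]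
  rw [← mul_sub, abs_mul, abs_of_nonneg (by positivity)] at hlt
  exact hlt.not_gt ((inv_lt_iff_one_lt_mul₀ (abs_pos.2 (sub_ne_zero.2 hxy))).1 hj)

theorem volume_adicIndex_eq_le (hq : 0 < q) (j m : ℕ) :
    volume {x ∈ Ico (0 : ℝ) 1 | adicIndex q j x = m} ≤ ((q : ℝ≥0∞) ^ j)⁻¹ := by
  have hqj : (0 : ℝ) < (q : ℝ) ^ j := by positivity
  have hsub : {x ∈ Ico (0 : ℝ) 1 | adicIndex q j x = m} ⊆
      Ico ((m : ℝ) / (q : ℝ) ^ j) ((m + 1) / (q : ℝ) ^ j) := by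
    rintro x ⟨hx, hxm⟩
    rw [mem_Ico, div_le_iff₀' hqj, lt_div_iff₀' hqj]
    exact (Nat.floor_eq_iff (mul_nonneg hqj.le hx.1)).1 hxm
  refine (measure_mono hsub).trans_eq ?_
  rw [Real.volume_Ico, ← sub_div, add_sub_cancel_left, one_div,
    ENNReal.ofReal_inv_of_pos hqj, ENNReal.ofReal_pow (by positivity), ENNReal.ofReal_natCast]

theorem exists_adic_labelling (hq : 2 ≤ q) (t : ℕ) :
    ∃ N : ℝ → ℕ+, ∀ x, ∃ i, q ^ t * (N x : ℕ) < q ^ i ∧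
      ∀ y, N y = N x → adicIndex q i y = adicIndex q i x := by
  have hq0 : 0 < q := two_pos.trans_le hq
  -- The `u`-th interval of level `t + 1` is divided into its `q ^ u` subintervals of level
  -- `t + 1 + u`, which are labelled by the numbers in `[q ^ u, q ^ (u + 1))`.
  let u : ℝ → ℕ := adicIndex q (t + 1)
  let v : ℝ → ℕ := fun x => adicIndex q (t + 1 + u x) x
  let N : ℝ → ℕ := fun x => q ^ u x + v x % q ^ u x
  have hNpos : ∀ x, 0 < N x := fun x => Nat.add_pos_left (pow_pos hq0 _) _
  have hNlt : ∀ x, N x < q ^ (u x + 1) := fun x =>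
    calc N x < q ^ u x + q ^ u x := Nat.add_lt_add_left (Nat.mod_lt _ (pow_pos hq0 _)) _
      _ = 2 * q ^ u x := (two_mul _).symm
      _ ≤ q ^ (u x + 1) := by rw [pow_succ']; exact Nat.mul_le_mul_right _ hq
  have hlog : ∀ x, Nat.log q (N x) = u x := fun x =>
    Nat.log_eq_of_pow_le_of_lt_pow (Nat.le_add_right _ _) (hNlt x)
  have hv : ∀ x, q ^ u x * u x + (N x - q ^ u x) = v x := fun x => by
    rw [Nat.add_sub_cancel_left, ← Nat.div_add_mod (v x) (q ^ u x), Nat.mul_add_mod_self_left,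
      Nat.mod_mod, adicIndex_add_div_pow hq0]
  refine ⟨fun x => ⟨N x, hNpos x⟩, fun x => ⟨t + 1 + u x, ?_, fun y hyx => ?_⟩⟩
  · rw [add_assoc, add_comm 1, pow_add]
    exact Nat.mul_lt_mul_of_pos_left (hNlt x) (pow_pos hq0 t)
  · have hN : N y = N x := congrArg PNat.val hyx
    have hu : u y = u x := by rw [← hlog, hN, hlog]
    have hvyx : v y = v x := by rw [← hv y, ← hv x, hN, hu]
    simpa only [v, hu] using hvyx

end AdicIndex

theorem one_le_tsum_volume_preimage {X ι : Type*} [Countable ι] {f : ℝ → X}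
    {B : ι → Set X} (hB : f '' Ico 0 1 ⊆ ⋃ i, B i) :
    1 ≤ ∑' i, volume (Ico (0 : ℝ) 1 ∩ f ⁻¹' B i) := by
  have hsub : Ico (0 : ℝ) 1 ⊆ ⋃ i, Ico (0 : ℝ) 1 ∩ f ⁻¹' B i := by
    rw [← inter_iUnion, ← preimage_iUnion]
    exact subset_inter subset_rfl (image_subset_iff.1 hB)
  calc (1 : ℝ≥0∞) = volume (Ico (0 : ℝ) 1) := by
        rw [Real.volume_Ico, sub_zero, ENNReal.ofReal_one]
    _ ≤ _ := (measure_mono hsub).trans (measure_iUnion_le _)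

/-- `f` codes the points of `[0, 1)` in a metric space so that two of them lie in the same `q`-adic
interval of length `q⁻ʲ` exactly when their images are at distance less than `d j`. -/
def IsAdicCoding {X : Type*} [MetricSpace X] (q : ℕ) (d : ℕ → ℝ≥0) (f : ℝ → X) : Prop :=
  ∀ x ∈ Ico (0 : ℝ) 1, ∀ y ∈ Ico (0 : ℝ) 1, ∀ j,
    adicIndex q j x = adicIndex q j y ↔ dist (f x) (f y) < d j

namespace IsAdicCoding

variable {X : Type*} [MetricSpace X] {q : ℕ} {d : ℕ → ℝ≥0} {f : ℝ → X} {φ : ℝ≥0 → ℝ≥0}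
  {s : ℕ+ → ℝ≥0} {A : Set X}

theorem of_dist_mem_Ico (hq : 2 ≤ q) (hd : Antitone d) (hd0 : ∀ j, 0 < d j)
    (h : ∀ x ∈ Ico (0 : ℝ) 1, ∀ y ∈ Ico (0 : ℝ) 1, ∀ j, adicIndex q j x = adicIndex q j y →
      adicIndex q (j + 1) x ≠ adicIndex q (j + 1) y →
        dist (f x) (f y) ∈ Ico (d (j + 1) : ℝ) (d j)) :
    IsAdicCoding q d f := by
  intro x hx y hy j
  by_cases hall : ∀ i, adicIndex q i x = adicIndex q i y
  · rw [eq_of_forall_adicIndex_eq hq hx.1 hy.1 hall, dist_self]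
    exact iff_of_true rfl (NNReal.coe_pos.2 (hd0 j))
  obtain ⟨i, hi, hi'⟩ := Nat.exists_not_and_succ_of_not_zero_of_exists
    (p := fun i => adicIndex q i x ≠ adicIndex q i y)
    (not_not.2 ((adicIndex_zero hx).trans (adicIndex_zero hy).symm)) (not_forall.1 hall)
  obtain ⟨hle, hlt⟩ := h x hx y hy i (not_not.1 hi) hi'
  have hq0 : 0 < q := two_pos.trans_le hq
  rcases le_or_gt j i with hji | hij
  · exact iff_of_true (adicIndex_eq_of_le hq0 hji (not_not.1 hi))
      (hlt.trans_le (NNReal.coe_le_coe.2 (hd hji)))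
  · exact iff_of_false (fun hj => hi' (adicIndex_eq_of_le hq0 hij hj))
      ((NNReal.coe_le_coe.2 (hd hij)).trans hle).not_gt

theorem comp_isometry {Y : Type*} [MetricSpace Y] (hf : IsAdicCoding q d f) {e : X → Y}
    (he : Isometry e) : IsAdicCoding q d (e ∘ f) := fun x hx y hy j => by
  rw [Function.comp_apply, Function.comp_apply, he.dist_eq]
  exact hf x hx y hy j

theorem ediam_image_le (hf : IsAdicCoding q d f) {S : Set ℝ} (hS : S ⊆ Ico 0 1) {j : ℕ}
    (h : ∀ x ∈ S, ∀ y ∈ S, adicIndex q j x = adicIndex q j y) :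
    Metric.ediam (f '' S) ≤ d j := by
  refine Metric.ediam_le ?_
  rintro _ ⟨x, hx, rfl⟩ _ ⟨y, hy, rfl⟩
  rw [edist_nndist, ENNReal.coe_le_coe]
  exact ((hf x (hS hx) y (hS hy) j).1 (h x hx y hy)).le

theorem volume_preimage_le (hf : IsAdicCoding q d f) (hq : 0 < q) {j : ℕ}
    (hA : Metric.ediam A < d j) :
    volume (Ico (0 : ℝ) 1 ∩ f ⁻¹' A) ≤ ((q : ℝ≥0∞) ^ j)⁻¹ := by
  rcases (Ico (0 : ℝ) 1 ∩ f ⁻¹' A).eq_empty_or_nonempty with hempty | ⟨x, hx, hxA⟩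
  · rw [hempty, measure_empty]
    exact zero_le
  refine (measure_mono ?_).trans (volume_adicIndex_eq_le hq j (adicIndex q j x))
  rintro y ⟨hy, hyA⟩
  have hdist : edist (f y) (f x) < d j :=
    (Metric.edist_le_ediam_of_mem (mem_preimage.1 hyA) hxA).trans_lt hA
  rw [edist_nndist, ENNReal.coe_lt_coe] at hdist
  exact ⟨hy, (hf y hy x hx j).2 hdist⟩

theorem volume_preimage_eq_zero (hf : IsAdicCoding q d f) (hq : 2 ≤ q) (hd : ∀ j, 0 < d j)
    (hA : Metric.ediam A = 0) : volume (Ico (0 : ℝ) 1 ∩ f ⁻¹' A) = 0 := by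
  have hlim : Tendsto (fun j : ℕ => ((q : ℝ≥0∞) ^ j)⁻¹) atTop (𝓝 0) := by
    simpa only [ENNReal.inv_pow] using ENNReal.tendsto_pow_atTop_nhds_zero_of_lt_one
      (ENNReal.inv_lt_one.2 (Nat.one_lt_cast.2 hq))
  refine le_antisymm (ge_of_tendsto' hlim fun j => ?_) zero_le
  exact hf.volume_preimage_le (two_pos.trans_le hq) (hA.trans_lt (ENNReal.coe_pos.2 (hd j)))

theorem div_mul_volume_preimage_le (hφ : IsGauge φ) (hf : IsAdicCoding q d f) (hq : 2 ≤ q)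
    (hd : ∀ j, 0 < d j) (hd0 : Tendsto d atTop (𝓝 0)) {c : ℝ≥0}
    (hc : ∀ j, c ≤ (q : ℝ≥0) ^ j * φ (d j)) (hA : Metric.ediam A < d 0) :
    ((c / q : ℝ≥0) : ℝ≥0∞) * volume (Ico (0 : ℝ) 1 ∩ f ⁻¹' A) ≤
      φ (Metric.ediam A).toNNReal := by
  have hq0 : 0 < q := two_pos.trans_le hq
  obtain ⟨r, hr⟩ : ∃ r : ℝ≥0, r = Metric.ediam A :=
    WithTop.ne_top_iff_exists.1 (hA.trans ENNReal.coe_lt_top).ne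
  rw [← hr] at hA
  rw [← hr, ENNReal.toNNReal_coe]
  rcases eq_zero_or_pos r with rfl | hr0
  · rw [hf.volume_preimage_eq_zero hq hd hr.symm, mul_zero]
    exact zero_le
  obtain ⟨j, hj, hj'⟩ := Nat.exists_not_and_succ_of_not_zero_of_exists (p := fun j => d j ≤ r)
    (ENNReal.coe_lt_coe.1 hA).not_ge (hd0.eventually_le_const hr0).exists
  have hcr : c / q * ((q : ℝ≥0) ^ j)⁻¹ ≤ φ r := by
    rw [← div_eq_mul_inv, div_div, div_le_iff₀' (by positivity), ← pow_succ']
    exact (hc (j + 1)).trans (mul_le_mul_right (hφ.mono hj') _)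
  calc ((c / q : ℝ≥0) : ℝ≥0∞) * volume (Ico (0 : ℝ) 1 ∩ f ⁻¹' A)
      ≤ (c / q : ℝ≥0) * ((q : ℝ≥0∞) ^ j)⁻¹ :=
        mul_le_mul_right (hf.volume_preimage_le hq0
          (hr.symm.trans_lt (ENNReal.coe_lt_coe.2 (not_le.1 hj)))) _
    _ = (c / q * ((q : ℝ≥0) ^ j)⁻¹ : ℝ≥0) := by
        rw [ENNReal.coe_mul, ENNReal.coe_inv (by positivity), ENNReal.coe_pow,
          ENNReal.coe_natCast]
    _ ≤ φ r := ENNReal.coe_le_coe.2 hcr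

theorem image_notMem_nullSets (hφ : IsGauge φ) (hf : IsAdicCoding q d f) (hq : 2 ≤ q)
    (hd : ∀ j, 0 < d j) (hd0 : Tendsto d atTop (𝓝 0)) {c : ℝ≥0} (hc0 : 0 < c)
    (hc : ∀ j, c ≤ (q : ℝ≥0) ^ j * φ (d j)) : f '' Ico 0 1 ∉ nullSets X φ := by
  intro hnull
  have hq0 : 0 < q := two_pos.trans_le hq
  have hcq : (0 : ℝ≥0∞) < (c / q : ℝ≥0) :=
    ENNReal.coe_pos.2 (div_pos hc0 (Nat.cast_pos.2 hq0))
  obtain ⟨B, hB, hdiam, hsum⟩ := (mem_nullSets_iff hφ).1 hnull (d 0) (hd 0) _ hcq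
  refine hsum.not_ge ?_
  calc ((c / q : ℝ≥0) : ℝ≥0∞)
      ≤ (c / q : ℝ≥0) * ∑' n, volume (Ico (0 : ℝ) 1 ∩ f ⁻¹' B n) :=
        le_mul_of_one_le_right' (one_le_tsum_volume_preimage hB)
    _ = ∑' n, (c / q : ℝ≥0) * volume (Ico (0 : ℝ) 1 ∩ f ⁻¹' B n) := ENNReal.tsum_mul_left.symm
    _ ≤ ∑' n, (φ (Metric.ediam (B n)).toNNReal : ℝ≥0∞) :=
        ENNReal.tsum_le_tsum fun n => hf.div_mul_volume_preimage_le hφ hq hd hd0 hc (hdiam n)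

theorem image_mem_dominatedSets (hf : IsAdicCoding q d f) (hq : 2 ≤ q) (hs : ∀ n, 0 < s n)
    (hd : ∀ j (n : ℕ+), (n : ℕ) < q ^ j → d j < s n) :
    f '' Ico 0 1 ∈ dominatedSets X (multClosure s) := by
  rintro _ ⟨k, rfl⟩
  obtain ⟨t, hkt⟩ : ∃ t, (k : ℕ) < q ^ t := ⟨(k : ℕ), Nat.lt_pow_self hq⟩
  obtain ⟨N, hN⟩ := exists_adic_labelling hq t
  refine ⟨fun n => f '' {x ∈ Ico (0 : ℝ) 1 | N x = n}, fun n => ?_, ?_⟩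
  · rcases {x ∈ Ico (0 : ℝ) 1 | N x = n}.eq_empty_or_nonempty with hempty | ⟨x, -, rfl⟩
    · simpa only [hempty, image_empty, Metric.ediam_empty, multShift] using
        ENNReal.coe_pos.2 (hs (k * n))
    obtain ⟨i, hi, hindex⟩ := hN x
    have hki : ((k * N x : ℕ+) : ℕ) < q ^ i :=
      (Nat.mul_le_mul_right _ hkt.le).trans_lt hi
    calc Metric.ediam (f '' {y ∈ Ico (0 : ℝ) 1 | N y = N x}) ≤ d i :=
          hf.ediam_image_le (fun y hy => hy.1) fun y hy z hz =>
            (hindex y hy.2).trans (hindex z hz.2).symm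
      _ < multShift k s (N x) := ENNReal.coe_lt_coe.2 (hd i _ hki)
  · rintro _ ⟨x, hx, rfl⟩
    exact mem_iUnion.2 ⟨N x, x, ⟨hx, rfl⟩, rfl⟩

theorem image_mem_nullSets (hφ : IsGauge φ) (hf : IsAdicCoding q d f) (hq : 0 < q)
    (hd0 : Tendsto d atTop (𝓝 0))
    (hlim : Tendsto (fun j => (q : ℝ≥0) ^ j * φ (d j)) atTop (𝓝 0)) :
    f '' Ico 0 1 ∈ nullSets X φ := by
  refine mem_nullSets_of_tendsto hφ (ENNReal.tendsto_coe.2 hlim) hd0 fun j => ?_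
  let B : ℕ → Set X := fun m => f '' {x ∈ Ico (0 : ℝ) 1 | adicIndex q j x = m}
  have hdiam : ∀ m, Metric.ediam (B m) ≤ d j := fun m =>
    hf.ediam_image_le (fun x hx => hx.1) fun x hx y hy => hx.2.trans hy.2.symm
  have hempty : ∀ m ∉ Finset.range (q ^ j), B m = ∅ := fun m hm =>
    image_eq_empty.2 <| eq_empty_of_forall_notMem fun x hx =>
      hm (Finset.mem_range.2 (hx.2 ▸ adicIndex_lt hq j hx.1))
  refine ⟨B, ?_, hdiam, ?_⟩
  · rintro _ ⟨x, hx, rfl⟩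
    exact mem_iUnion.2 ⟨adicIndex q j x, x, ⟨hx, rfl⟩, rfl⟩
  calc ∑' m, (φ (Metric.ediam (B m)).toNNReal : ℝ≥0∞)
      = ∑ m ∈ Finset.range (q ^ j), (φ (Metric.ediam (B m)).toNNReal : ℝ≥0∞) :=
        tsum_eq_sum fun _ hm => by
          rw [hempty _ hm, Metric.ediam_empty, ENNReal.toNNReal_zero, hφ.map_zero,
            ENNReal.coe_zero]
    _ ≤ ∑ _m ∈ Finset.range (q ^ j), (φ (d j) : ℝ≥0∞) :=
        Finset.sum_le_sum fun m _ => ENNReal.coe_le_coe.2 (hφ.apply_ediam_le (hdiam m))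
    _ = ((q : ℝ≥0) ^ j * φ (d j) : ℝ≥0) := by
        rw [Finset.sum_const, Finset.card_range, nsmul_eq_mul, ENNReal.coe_mul, ENNReal.coe_pow,
          ENNReal.coe_natCast, Nat.cast_pow]

theorem volume_preimage_le_tsum {n : ℕ → ℕ+} (hf : IsAdicCoding q (fun j => s (n j)) f)
    (hq : 0 < q) (hs : Antitone s) (hn : Tendsto n atTop atTop) {N : ℕ+} (hN : n 0 ≤ N)
    (hA : Metric.ediam A < s N) :
    volume (Ico (0 : ℝ) 1 ∩ f ⁻¹' A) ≤
      ∑' j, if N < n (j + 1) then ((q : ℝ≥0∞) ^ j)⁻¹ else 0 := by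
  obtain ⟨j, hj, hj'⟩ := Nat.exists_not_and_succ_of_not_zero_of_exists (p := fun j => N < n j)
    hN.not_gt (hn.eventually_gt_atTop N).exists
  calc volume (Ico (0 : ℝ) 1 ∩ f ⁻¹' A)
      ≤ ((q : ℝ≥0∞) ^ j)⁻¹ :=
        hf.volume_preimage_le hq (hA.trans_le (ENNReal.coe_le_coe.2 (hs (not_lt.1 hj))))
    _ = if N < n (j + 1) then ((q : ℝ≥0∞) ^ j)⁻¹ else 0 := (if_pos hj').symm
    _ ≤ _ := ENNReal.le_tsum j

theorem image_notMem_dominatedSets {n : ℕ → ℕ+} (hf : IsAdicCoding q (fun j => s (n j)) f)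
    (hq : 0 < q) (hs : Antitone s) (hn : Tendsto n atTop atTop)
    (hsum : ∑' j, ((n (j + 1) : ℕ) : ℝ≥0∞) * ((q : ℝ≥0∞) ^ j)⁻¹ ≠ ∞) :
    f '' Ico 0 1 ∉ dominatedSets X (multClosure s) := by
  intro hdom
  obtain ⟨k₀, hk₀⟩ := ENNReal.exists_nat_gt hsum
  let k : ℕ+ := n 0 + k₀.succPNat
  have hk : (k₀ : ℝ≥0∞) ≤ (k : ℕ) :=
    Nat.cast_le.2 (k₀.le_succ.trans (Nat.le_add_left _ _))
  obtain ⟨B, hB, hcover⟩ := hdom _ ⟨k, rfl⟩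
  refine (hk₀.trans_le hk).not_ge ?_
  calc ((k : ℕ) : ℝ≥0∞)
      ≤ (k : ℕ) * ∑' m, volume (Ico (0 : ℝ) 1 ∩ f ⁻¹' B m) :=
        le_mul_of_one_le_right' (one_le_tsum_volume_preimage hcover)
    _ ≤ (k : ℕ) * ∑' (m : ℕ+) (j), if k * m < n (j + 1) then ((q : ℝ≥0∞) ^ j)⁻¹ else 0 := by
        gcongr with m
        exact hf.volume_preimage_le_tsum hq hs hn
          ((PNat.lt_add_right _ _).le.trans (le_mul_of_one_le_right' one_le)) (hB m)
    _ = ∑' j, (k : ℕ) * ∑' m : ℕ+, if k * m < n (j + 1) then ((q : ℝ≥0∞) ^ j)⁻¹ else 0 := by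
        rw [ENNReal.tsum_comm, ENNReal.tsum_mul_left]
    _ ≤ ∑' j, ((n (j + 1) : ℕ) : ℝ≥0∞) * ((q : ℝ≥0∞) ^ j)⁻¹ :=
        ENNReal.tsum_le_tsum fun j => mul_tsum_ite_mul_lt_le _ _ _

end IsAdicCoding

section EllTwoCoding

theorem hasSum_sub_succ {r : ℕ → ℝ} (hr : Antitone r) (hr0 : Tendsto r atTop (𝓝 0)) :
    HasSum (fun i => r i - r (i + 1)) (r 0) := by
  rw [hasSum_iff_tendsto_nat_of_nonneg fun i => sub_nonneg.2 (hr i.le_succ)]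
  simpa only [Finset.sum_range_sub', sub_zero] using hr0.const_sub (r 0)

/-- The family indexed by the edges of the tree of height `ω` that takes the value `c j` at the
`j`-th edge of the branch `u`, and `0` at the edges outside `u`. -/
noncomputable def branchFun (c : ℕ → ℝ) (u : ℕ → ℕ) (p : ℕ × ℕ) : ℝ :=
  if p.2 = u p.1 then c p.1 else 0

theorem hasSum_branchFun_mul_iff {c : ℕ → ℝ} {u v : ℕ → ℕ} {a : ℝ} :
    HasSum (fun p => branchFun c u p * branchFun c v p) a ↔
      HasSum (fun j => if u j = v j then c j ^ 2 else 0) a := by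
  have hinj : Function.Injective fun j => (j, u j) := fun i j h => congrArg Prod.fst h
  rw [← hinj.hasSum_iff]
  · refine iff_of_eq (congrArg (HasSum · a) (funext fun j => ?_))
    simp only [Function.comp_apply, branchFun, if_true, mul_ite, mul_zero, sq]
  · rintro ⟨j, m⟩ hm
    have hmu : m ≠ u j := fun h => hm ⟨j, by rw [h]⟩
    rw [branchFun, if_neg hmu, zero_mul]

theorem exists_ellTwo_hasSum_inner {c : ℕ → ℝ} (hc : Summable fun j => c j ^ 2) :
    ∃ F : (ℕ → ℕ) → EllTwo, ∀ u v,
      HasSum (fun j => if u j = v j then c j ^ 2 else 0) (inner ℝ (F u) (F v)) := by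
  let e : ℕ+ ≃ ℕ × ℕ := Denumerable.equiv₂ _ _
  have hmem : ∀ u, Memℓp (fun i => branchFun c u (e i)) 2 := fun u => by
    refine memℓp_gen ?_
    have hsq : Summable fun p => branchFun c u p ^ 2 := by
      have hdiag : HasSum (fun j => if u j = u j then c j ^ 2 else 0) (∑' j, c j ^ 2) := by
        simpa only [if_true] using hc.hasSum
      simpa only [sq] using (hasSum_branchFun_mul_iff.2 hdiag).summable
    simpa only [Function.comp_def, ENNReal.toReal_ofNat, Real.rpow_two, Real.norm_eq_abs, sq_abs]
      using e.summable_iff.2 hsq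
  refine ⟨fun u => ⟨_, hmem u⟩, fun u v => hasSum_branchFun_mul_iff.1 (e.hasSum_iff.1 ?_)⟩
  simpa only [Function.comp_def, RCLike.inner_apply, conj_trivial, mul_comm] using
    lp.hasSum_inner (𝕜 := ℝ) (⟨_, hmem u⟩ : EllTwo) ⟨_, hmem v⟩

theorem exists_ellTwo_dist_eq {d : ℕ → ℝ≥0} (hd : Antitone d) (hd0 : Tendsto d atTop (𝓝 0)) :
    ∃ F : (ℕ → ℕ) → EllTwo, ∀ u v J, (∀ i, u i = v i ↔ i < J) → dist (F u) (F v) = d J := by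
  let r : ℕ → ℝ := fun j => (d j : ℝ) ^ 2 / 2
  have hr : Antitone r := fun i j hij => by
    have hdij : (d j : ℝ) ≤ d i := hd hij
    simp only [r]
    gcongr
  have hr0 : Tendsto r atTop (𝓝 0) := by
    simpa using ((NNReal.tendsto_coe.2 hd0).pow 2).div_const 2
  let c : ℕ → ℝ := fun j => √(r j - r (j + 1))
  have hc : ∀ j, c j ^ 2 = r j - r (j + 1) := fun j => Real.sq_sqrt (sub_nonneg.2 (hr j.le_succ))
  have hcsum : HasSum (fun j => c j ^ 2) (r 0) := by
    simpa only [hc] using hasSum_sub_succ hr hr0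
  obtain ⟨F, hF⟩ := exists_ellTwo_hasSum_inner hcsum.summable
  have hnorm : ∀ u, ‖F u‖ ^ 2 = r 0 := fun u => by
    rw [← real_inner_self_eq_norm_sq]
    exact (hF u u).unique (by simpa only [if_true] using hcsum)
  refine ⟨F, fun u v J huv => ?_⟩
  have hinner : inner ℝ (F u) (F v) = r 0 - r J := by
    refine (hF u v).unique ?_
    simp only [huv, hc]
    rw [← Finset.sum_range_sub' r J, Finset.sum_congr rfl fun i hi =>
      (if_pos (Finset.mem_range.1 hi)).symm]
    exact hasSum_sum_of_ne_finset_zero fun i hi => if_neg (Finset.mem_range.not.1 hi)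
  rw [dist_eq_norm]
  refine (sq_eq_sq₀ (norm_nonneg _) (d J).coe_nonneg).1 ?_
  rw [norm_sub_sq_real, hnorm, hnorm, hinner]
  simp only [r]
  ring

theorem exists_isAdicCoding_ellTwo {q : ℕ} (hq : 2 ≤ q) {d : ℕ → ℝ≥0} (hd : StrictAnti d)
    (hd0 : Tendsto d atTop (𝓝 0)) : ∃ f : ℝ → EllTwo, IsAdicCoding q d f := by
  have hq0 : 0 < q := two_pos.trans_le hq
  obtain ⟨F, hF⟩ := exists_ellTwo_dist_eq hd.antitone hd0
  refine ⟨fun x => F fun j => adicIndex q j x, .of_dist_mem_Ico hq hd.antitone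
    (fun j => zero_le.trans_lt (hd j.lt_succ_self)) fun x _ y _ j hj hj' => ?_⟩
  have hagree : ∀ i, adicIndex q i x = adicIndex q i y ↔ i < j + 1 := fun i =>
    ⟨fun hi => not_le.1 fun hji => hj' (adicIndex_eq_of_le hq0 hji hi),
      fun hij => adicIndex_eq_of_le hq0 (Nat.lt_succ_iff.1 hij) hj⟩
  rw [hF _ _ _ hagree]
  exact ⟨le_rfl, hd j.lt_succ_self⟩

end EllTwoCoding

section RealCoding

variable {d g : ℕ → ℝ}

theorem abs_le_geometric (hd : ∀ j, 4 * d (j + 1) ≤ d j) (hg : ∀ i, |g i| ≤ d i / 2) (i : ℕ) :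
    |g i| ≤ (1 / 4) ^ i * (d 0 / 2) := by
  have hdi : d i ≤ (1 / 4) ^ i * d 0 := le_geom (by norm_num) i fun k _ => by linarith [hd k]
  linarith [hg i]

theorem hasSum_quarter_pow (a : ℝ) :
    HasSum (fun i : ℕ => (1 / 4 : ℝ) ^ i * (a / 2)) (2 / 3 * a) := by
  have h := (hasSum_geometric_of_lt_one (r := (1 / 4 : ℝ)) (by norm_num) (by norm_num)).mul_right
    (a / 2)
  rwa [show (1 - 1 / 4 : ℝ)⁻¹ * (a / 2) = 2 / 3 * a by ring] at h

theorem summable_of_abs_le (hd : ∀ j, 4 * d (j + 1) ≤ d j) (hg : ∀ i, |g i| ≤ d i / 2) :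
    Summable g :=
  (hasSum_quarter_pow (d 0)).summable.of_norm_bounded (abs_le_geometric hd hg)

theorem abs_tsum_le (hd : ∀ j, 4 * d (j + 1) ≤ d j) (hg : ∀ i, |g i| ≤ d i / 2) :
    |∑' i, g i| ≤ 2 / 3 * d 0 := by
  rw [← Real.norm_eq_abs]
  exact tsum_of_norm_bounded (hasSum_quarter_pow (d 0)) (abs_le_geometric hd hg)

theorem abs_tsum_mem_Ico (hd0 : ∀ j, 0 < d j) (hd : ∀ j, 4 * d (j + 1) ≤ d j)
    (hg : ∀ i, |g i| ≤ d i / 2) {j : ℕ} (hzero : ∀ i < j, g i = 0)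
    (hj : 2 * d (j + 1) ≤ |g j|) : |∑' i, g i| ∈ Ico (d (j + 1)) (d j) := by
  have hsplit : ∑' i, g i = g j + ∑' i, g (i + (j + 1)) := by
    rw [← (summable_of_abs_le hd hg).sum_add_tsum_nat_add (j + 1), Finset.sum_range_succ,
      Finset.sum_eq_zero fun i hi => hzero i (Finset.mem_range.1 hi), zero_add]
  have htail : |∑' i, g (i + (j + 1))| ≤ 2 / 3 * d (j + 1) := by
    simpa only [zero_add] using abs_tsum_le (d := fun i => d (i + (j + 1)))
      (fun i => by simpa only [add_right_comm] using hd (i + (j + 1))) fun i => hg _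
  have hlower := abs_sub_abs_le_abs_add (g j) (∑' i, g (i + (j + 1)))
  have hupper := abs_add_le (g j) (∑' i, g (i + (j + 1)))
  rw [hsplit]
  constructor <;> linarith [hg j, hd j, hd0 j, hd0 (j + 1)]

/-- The `j`-th digit after the point in the `q`-adic expansion of `x`, counted from `0`. -/
noncomputable def adicDigit (q j : ℕ) (x : ℝ) : ℕ := adicIndex q (j + 1) x % q

theorem mul_adicIndex_add_adicDigit {q : ℕ} (hq : 0 < q) (j : ℕ) (x : ℝ) :
    q * adicIndex q j x + adicDigit q j x = adicIndex q (j + 1) x := by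
  rw [← adicIndex_add_div_pow hq j 1 x, pow_one, adicDigit, Nat.div_add_mod]

theorem exists_isAdicCoding_real {q : ℕ} (hq : 2 ≤ q) {d : ℕ → ℝ≥0} (hd0 : ∀ j, 0 < d j)
    (hd : ∀ j, 4 * q * d (j + 1) ≤ d j) : ∃ f : ℝ → ℝ, IsAdicCoding q d f := by
  have hq0 : 0 < q := two_pos.trans_le hq
  have hdq : ∀ j, 4 * (q : ℝ) * d (j + 1) ≤ d j := fun j => by exact_mod_cast hd j
  have hd4 : ∀ j, 4 * (d (j + 1) : ℝ) ≤ d j := fun j => (hdq j).trans' <| by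
    gcongr
    exact le_mul_of_one_le_right (by norm_num) (by exact_mod_cast hq0)
  let w : ℕ → ℝ := fun j => d j / (2 * q)
  have hqw : ∀ j, q * w j = d j / 2 := fun j => by simp only [w]; field_simp
  have hdigit : ∀ j x, (adicDigit q j x : ℝ) ∈ Icc (0 : ℝ) q := fun j x =>
    ⟨Nat.cast_nonneg _, Nat.cast_le.2 (Nat.mod_lt _ hq0).le⟩
  have hw : ∀ j (t : ℝ), |t| ≤ q → |t * w j| ≤ d j / 2 := fun j t ht => by
    rw [abs_mul, abs_of_nonneg (show 0 ≤ w j by positivity), ← hqw]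
    gcongr
  have hsum : ∀ x, Summable fun j => adicDigit q j x * w j := fun x =>
    summable_of_abs_le hd4 fun j => hw j _ (by
      rw [abs_of_nonneg (hdigit j x).1]
      exact (hdigit j x).2)
  refine ⟨fun x => ∑' j, adicDigit q j x * w j, .of_dist_mem_Ico hq
    (antitone_nat_of_succ_le fun j => NNReal.coe_le_coe.1 ?_) hd0 fun x _ y _ j hj hj' => ?_⟩
  · linarith [hd4 j, (d (j + 1)).2]
  rw [Real.dist_eq, ← (hsum x).tsum_sub (hsum y)]
  simp only [← sub_mul]
  refine abs_tsum_mem_Ico (d := fun j => (d j : ℝ)) hd0 hd4 (fun i => hw i _ ?_) (fun i hi => ?_) ?_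
  · exact abs_sub_le_of_nonneg_of_le (hdigit i x).1 (hdigit i x).2 (hdigit i y).1 (hdigit i y).2
  · rw [adicDigit, adicDigit, adicIndex_eq_of_le hq0 hi hj, sub_self, zero_mul]
  · have hne : adicDigit q j x ≠ adicDigit q j y := fun h => hj' <| by
      rw [← mul_adicIndex_add_adicDigit hq0, hj, h, mul_adicIndex_add_adicDigit hq0]
    have hone : 1 ≤ |(adicDigit q j x : ℝ) - adicDigit q j y| := by
      exact_mod_cast Int.one_le_abs (sub_ne_zero.2 (Nat.cast_injective.ne hne))
    rw [abs_mul, abs_of_nonneg (show 0 ≤ w j by positivity)]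
    refine le_trans ?_ (le_mul_of_one_le_left (by positivity) hone)
    rw [le_div_iff₀ (by positivity)]
    linarith [hdq j]

end RealCoding

section Doubling

variable {L : ℝ≥0} {φ : ℝ≥0 → ℝ≥0} {s : ℕ+ → ℝ≥0} {a b : ℝ≥0}

theorem IsDoublingWith.exists_apply_two_pow_mul_le (h : IsDoublingWith L φ) :
    ∃ R, 0 < R ∧ ∀ (i : ℕ) (r : ℝ≥0), 0 < r → 2 ^ i * r ≤ R → φ (2 ^ i * r) ≤ L ^ i * φ r := by
  obtain ⟨R, hR, hdouble⟩ := h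
  refine ⟨R, hR, fun i => ?_⟩
  induction i with
  | zero => intro r _ _; simp only [pow_zero, one_mul, le_refl]
  | succ i ih =>
    intro r hr hri
    have hir : 2 ^ i * r ≤ R := hri.trans' <| by
      gcongr
      exacts [one_le_two, i.le_succ]
    calc φ (2 ^ (i + 1) * r) = φ (2 * (2 ^ i * r)) := by rw [pow_succ', mul_assoc]
      _ ≤ L * φ (2 ^ i * r) := hdouble _ (by positivity) hir
      _ ≤ L * (L ^ i * φ r) := by gcongr; exact ih r hr hir
      _ = L ^ (i + 1) * φ r := by rw [pow_succ', mul_assoc]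

theorem exists_pow_add_mul_lt (hL : L < 2) (ha : 0 < a) (b : ℝ≥0) (k : ℕ) :
    ∃ M, 0 < M ∧ L ^ (M + k) * b < a * 2 ^ M := by
  have hlim : Tendsto (fun M : ℕ => (L / 2) ^ M * (L ^ k * b)) atTop (𝓝 0) := by
    simpa only [zero_mul] using (NNReal.tendsto_pow_atTop_nhds_zero_of_lt_one
      ((div_lt_one two_pos).2 hL)).mul_const (L ^ k * b)
  obtain ⟨M, hM0, hM⟩ := ((eventually_gt_atTop 0).and (hlim.eventually (gt_mem_nhds ha))).exists
  refine ⟨M, hM0, ?_⟩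
  rwa [div_pow, div_mul_eq_mul_div, div_lt_iff₀ (by positivity), ← mul_assoc, ← pow_add] at hM

theorem IsDoublingWith.exists_sixteen_mul_le (h : IsDoublingWith L φ) (hL : L < 2)
    (hφ : IsGauge φ) (hs : s ∈ nullSequences) (ha : 0 < a)
    (has : ∀ n : ℕ+, a ≤ ((n : ℕ) : ℝ≥0) * φ (s n))
    (hbs : ∀ n : ℕ+, ((n : ℕ) : ℝ≥0) * φ (s n) ≤ b) :
    ∃ p, 2 ≤ p ∧ ∃ K, ∀ n m : ℕ+, K ≤ n → p * n ≤ m → 16 * (p : ℕ) * s m ≤ s n := by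
  obtain ⟨R, hR, hiter⟩ := h.exists_apply_two_pow_mul_le
  obtain ⟨M, hM0, hM⟩ := exists_pow_add_mul_lt hL ha b 4
  obtain ⟨K, hK⟩ := (hs.2.2.eventually
    (ge_mem_nhds (show 0 < R / 2 ^ (M + 4) by positivity))).exists
  refine ⟨2 ^ M, le_self_pow one_le hM0.ne', K, fun n m hn hm => ?_⟩
  have hpow : (16 : ℝ≥0) * ((2 ^ M : ℕ+) : ℕ) = 2 ^ (M + 4) := by push_cast; ring
  rw [hpow]
  by_contra! hlt
  have hnm : n ≤ m := le_of_mul_le_of_one_le_right hm one_le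
  have hsm : 2 ^ (M + 4) * s m ≤ R :=
    (le_div_iff₀' (by positivity)).1 ((hs.1.antitone (hn.trans hnm)).trans hK)
  have hφn : φ (s n) ≤ L ^ (M + 4) * φ (s m) :=
    (hφ.mono hlt.le).trans (hiter _ _ (hs.2.1 m) hsm)
  refine hM.not_ge ?_
  calc a * 2 ^ M ≤ (n : ℕ) * φ (s n) * 2 ^ M := by gcongr; exact has n
    _ = ((2 ^ M * n : ℕ+) : ℕ) * φ (s n) := by push_cast; ring
    _ ≤ (m : ℕ) * (L ^ (M + 4) * φ (s m)) :=
        mul_le_mul' (Nat.cast_le.2 (PNat.coe_le_coe _ _ |>.2 hm)) hφn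
    _ = L ^ (M + 4) * ((m : ℕ) * φ (s m)) := by ring
    _ ≤ L ^ (M + 4) * b := by gcongr; exact hbs m

end Doubling

section SparseSequences

variable {p : ℕ+} {n : ℕ → ℕ+}

theorem strictMono_of_mul_le_succ (hp : 2 ≤ p) (hn : ∀ j, p * n j ≤ n (j + 1)) : StrictMono n :=
  strictMono_nat_of_lt_succ fun j =>
    (lt_mul_of_one_lt_left' (n j) (lt_of_lt_of_le (by decide) hp)).trans_le (hn j)

theorem two_pow_le_of_mul_le_succ (hp : 2 ≤ p) (hn : ∀ j, p * n j ≤ n (j + 1)) (j : ℕ) :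
    2 ^ j ≤ n j := by
  induction j with
  | zero => exact one_le
  | succ j ih =>
    rw [pow_succ']
    exact (mul_le_mul' hp ih).trans (hn j)

theorem tendsto_atTop_of_mul_le_succ (hp : 2 ≤ p) (hn : ∀ j, p * n j ≤ n (j + 1)) :
    Tendsto n atTop atTop :=
  tendsto_atTop_atTop_of_monotone (strictMono_of_mul_le_succ hp hn).monotone fun m =>
    ⟨m, StrictMono.le_apply (f := fun j => (n j : ℕ))
      (strictMono_of_mul_le_succ hp hn)⟩

end SparseSequences

/-- `X` has adic codings along all `p`-sparse subsequences of `s` that start at an index at least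
`K`. The base `4 * p` leaves room for sparse subsequences `n j` with `n j * (j + 1) ^ 2` of order
`(4 * p) ^ j`. -/
def HasAdicCodings (X : Type*) [MetricSpace X] (s : ℕ+ → ℝ≥0) (p K : ℕ+) : Prop :=
  ∀ n : ℕ → ℕ+, K ≤ n 0 → (∀ j, p * n j ≤ n (j + 1)) →
    ∃ f : ℝ → X, IsAdicCoding (4 * p) (fun j => s (n j)) f

namespace HasAdicCodings

variable {X Y : Type*} [MetricSpace X] [MetricSpace Y] {s : ℕ+ → ℝ≥0} {p K : ℕ+}

theorem of_isometry (h : HasAdicCodings X s p K) {e : X → Y} (he : Isometry e) :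
    HasAdicCodings Y s p K := fun n hK hn =>
  let ⟨f, hf⟩ := h n hK hn
  ⟨e ∘ f, hf.comp_isometry he⟩

theorem ellTwo (hs : s ∈ nullSequences) : HasAdicCodings EllTwo s 2 1 := fun _ _ hn =>
  exists_isAdicCoding_ellTwo (by norm_num)
    (hs.1.comp_strictMono (strictMono_of_mul_le_succ le_rfl hn))
    (hs.2.2.comp (tendsto_atTop_of_mul_le_succ le_rfl hn))

theorem real (hs : ∀ n, 0 < s n) (hp : 2 ≤ p)
    (h : ∀ n m : ℕ+, K ≤ n → p * n ≤ m → 16 * (p : ℕ) * s m ≤ s n) :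
    HasAdicCodings ℝ s p K := fun n hK hn => by
  have hKn : ∀ j, K ≤ n j := fun j =>
    hK.trans ((strictMono_of_mul_le_succ hp hn).monotone j.zero_le)
  refine exists_isAdicCoding_real (by linarith [p.pos]) (fun j => hs _) fun j => ?_
  convert h _ _ (hKn j) (hn j) using 2
  push_cast
  ring

end HasAdicCodings

section Strictness

variable {X : Type*} [MetricSpace X] {φ : ℝ≥0 → ℝ≥0} {s : ℕ+ → ℝ≥0} {a b : ℝ≥0} {p K : ℕ+}

theorem exists_mem_dominatedSets_notMem_nullSets (hφ : IsGauge φ) (hs : s ∈ nullSequences)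
    (ha : 0 < a) (has : ∀ n : ℕ+, a ≤ ((n : ℕ) : ℝ≥0) * φ (s n)) (hp : 2 ≤ p)
    (hX : HasAdicCodings X s p K) : ∃ E ∈ dominatedSets X (multClosure s), E ∉ nullSets X φ := by
  have hq : 2 ≤ 4 * (p : ℕ) := by linarith [p.pos]
  have hK : (0 : ℝ≥0) < (K : ℕ) := by exact_mod_cast K.pos
  let n : ℕ → ℕ+ := fun j => K * (4 * p) ^ j
  have hn : ∀ j, (n j : ℕ) = K * (4 * p) ^ j := fun j => by simp [n]
  have hsparse : ∀ j, p * n j ≤ n (j + 1) := fun j => by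
    rw [show n (j + 1) = 4 * (p * n j) by simp only [n]; ring]
    exact le_mul_of_one_le_left' one_le
  obtain ⟨f, hf⟩ := hX n (by simp [n]) hsparse
  have hdom : ∀ j (m : ℕ+), (m : ℕ) < (4 * p) ^ j → s (n j) < s m := fun j m hm =>
    hs.1 <| (PNat.coe_lt_coe _ _).1 <|
      (hm.trans_le (Nat.le_mul_of_pos_left _ K.pos)).trans_eq (hn j).symm
  have hmass : ∀ j, a / (K : ℕ) ≤ ((4 * p : ℕ) : ℝ≥0) ^ j * φ (s (n j)) := fun j => by
    rw [div_le_iff₀' hK, ← mul_assoc]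
    exact (has (n j)).trans_eq (by rw [hn]; push_cast; ring)
  exact ⟨f '' Ico 0 1, hf.image_mem_dominatedSets hq hs.2.1 hdom,
    hf.image_notMem_nullSets hφ hq (fun j => hs.2.1 _)
      (hs.2.2.comp (tendsto_atTop_of_mul_le_succ hp hsparse)) (div_pos ha hK) hmass⟩

/-- A sequence of positive integers of order `(4 * p) ^ j / (j + 1) ^ 2`, in which `(j + 1) ^ 2` is
replaced by a power of `4` so that each term is a multiple of `p` times the previous one. -/
def dampedPow (p : ℕ+) (j : ℕ) : ℕ+ := p ^ j * 4 ^ (j - Nat.log 2 (j + 1))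

theorem dampedPow_mul_two_pow_log_sq (p : ℕ+) (j : ℕ) :
    (dampedPow p j : ℕ) * (2 ^ Nat.log 2 (j + 1)) ^ 2 = (4 * p) ^ j := by
  have hlog : Nat.log 2 (j + 1) ≤ j := Nat.lt_succ_iff.1 (Nat.log_lt_self 2 j.succ_ne_zero)
  have hsq : (2 ^ Nat.log 2 (j + 1)) ^ 2 = 4 ^ Nat.log 2 (j + 1) := pow_right_comm 2 _ 2
  have hfour : ((4 : ℕ+) : ℕ) = 4 := rfl
  rw [dampedPow, PNat.mul_coe, PNat.pow_coe, PNat.pow_coe, hfour, hsq, mul_assoc, ← pow_add,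
    Nat.sub_add_cancel hlog, ← mul_pow, mul_comm]

theorem mul_dampedPow_le_succ (p : ℕ+) (j : ℕ) : p * dampedPow p j ≤ dampedPow p (j + 1) := by
  have hlog : Nat.log 2 (j + 1 + 1) ≤ Nat.log 2 (j + 1) + 1 := by
    rw [← Nat.log_mul_base one_lt_two j.succ_ne_zero]
    exact Nat.log_mono_right (by lia)
  have hexp : j - Nat.log 2 (j + 1) ≤ j + 1 - Nat.log 2 (j + 1 + 1) := by lia
  rw [dampedPow, dampedPow, ← mul_assoc, ← pow_succ']
  exact mul_le_mul_right (pow_le_pow_right' one_le hexp) _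

theorem pow_le_dampedPow_mul_sq (p : ℕ+) (j : ℕ) :
    (4 * p : ℕ) ^ j ≤ dampedPow p j * (j + 1) ^ 2 := by
  rw [← dampedPow_mul_two_pow_log_sq]
  gcongr
  exact Nat.pow_log_le_self 2 j.succ_ne_zero

theorem dampedPow_mul_sq_le (p : ℕ+) (j : ℕ) :
    (dampedPow p j : ℕ) * (j + 1) ^ 2 ≤ 4 * (4 * p) ^ j := by
  have hlog : j + 1 ≤ 2 ^ (Nat.log 2 (j + 1) + 1) := (Nat.lt_pow_succ_log_self one_lt_two _).le
  calc (dampedPow p j : ℕ) * (j + 1) ^ 2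
      ≤ (dampedPow p j : ℕ) * (2 ^ (Nat.log 2 (j + 1) + 1)) ^ 2 := by gcongr
    _ = 4 * ((dampedPow p j : ℕ) * (2 ^ Nat.log 2 (j + 1)) ^ 2) := by ring
    _ = 4 * (4 * p) ^ j := by rw [dampedPow_mul_two_pow_log_sq]

theorem tendsto_succ_sq_mul_pow {ρ : ℝ≥0} (hρ : ρ < 1) :
    Tendsto (fun j : ℕ => ((j + 1 : ℕ) : ℝ≥0) ^ 2 * ρ ^ j) atTop (𝓝 0) := by
  rcases eq_or_ne ρ 0 with rfl | hρ0
  · refine tendsto_const_nhds.congr' ((eventually_ne_atTop 0).mono fun j hj => ?_)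
    simp only [zero_pow hj, mul_zero]
  have h : Tendsto (fun j : ℕ => (j : ℝ≥0) ^ 2 * ρ ^ j) atTop (𝓝 0) := by
    rw [← NNReal.tendsto_coe]
    push_cast
    exact tendsto_pow_const_mul_const_pow_of_lt_one 2 ρ.coe_nonneg hρ
  have hshift := (h.comp (tendsto_add_atTop_nat 1)).mul_const ρ⁻¹
  rw [zero_mul] at hshift
  refine hshift.congr fun j => ?_
  rw [Function.comp_apply, mul_assoc, pow_succ ρ, mul_inv_cancel_right₀ hρ0]

theorem tendsto_pow_mul_gaugePow (hbs : ∀ n : ℕ+, ((n : ℕ) : ℝ≥0) * φ (s n) ≤ b) {q : ℕ}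
    {n : ℕ → ℕ+} (hn : ∀ j, 2 ^ j ≤ n j) (hq : ∀ j, q ^ j ≤ (n j : ℕ) * (j + 1) ^ 2) {α : ℝ}
    (hα : 1 < α) : Tendsto (fun j => (q : ℝ≥0) ^ j * gaugePow φ α (s (n j))) atTop (𝓝 0) := by
  have hρ : (2 : ℝ≥0) ^ (1 - α) < 1 :=
    NNReal.rpow_lt_one_of_one_lt_of_neg one_lt_two (sub_neg.2 hα)
  refine tendsto_of_tendsto_of_tendsto_of_le_of_le tendsto_const_nhds
    (by simpa only [mul_zero] using (tendsto_succ_sq_mul_pow hρ).const_mul (b ^ α))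
    (fun _ => zero_le) fun j => ?_
  have hnj : (0 : ℝ≥0) < (n j : ℕ) := by exact_mod_cast (n j).pos
  have hφn : φ (s (n j)) ≤ b / (n j : ℕ) := (le_div_iff₀' hnj).2 (hbs _)
  have hpow : ((n j : ℕ) : ℝ≥0) ^ (1 - α) ≤ (2 ^ (1 - α)) ^ j := by
    rw [← NNReal.rpow_natCast, ← NNReal.rpow_mul, mul_comm, NNReal.rpow_mul, NNReal.rpow_natCast]
    refine NNReal.rpow_le_rpow_of_nonpos (by positivity) ?_ (sub_neg.2 hα).le
    exact_mod_cast hn j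
  calc (q : ℝ≥0) ^ j * gaugePow φ α (s (n j))
      ≤ ((n j : ℕ) * ((j + 1 : ℕ) : ℝ≥0) ^ 2) * (b / (n j : ℕ)) ^ α := by
        refine mul_le_mul' (by exact_mod_cast hq j) ?_
        exact NNReal.rpow_le_rpow hφn (by linarith)
    _ = b ^ α * (((j + 1 : ℕ) : ℝ≥0) ^ 2 * ((n j : ℕ) : ℝ≥0) ^ (1 - α)) := by
        rw [NNReal.div_rpow, NNReal.rpow_sub hnj.ne', NNReal.rpow_one]
        ring
    _ ≤ b ^ α * (((j + 1 : ℕ) : ℝ≥0) ^ 2 * (2 ^ (1 - α)) ^ j) := by gcongr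

theorem tsum_mul_inv_pow_ne_top {q C : ℕ} (hq : 0 < q) {n : ℕ → ℕ+}
    (hn : ∀ j, (n j : ℕ) * (j + 1) ^ 2 ≤ C * q ^ j) :
    ∑' j, ((n (j + 1) : ℕ) : ℝ≥0∞) * ((q : ℝ≥0∞) ^ j)⁻¹ ≠ ∞ := by
  have hinv : Summable fun j : ℕ => ((j : ℝ≥0) ^ 2)⁻¹ := by
    rw [← NNReal.summable_coe]
    push_cast
    exact Real.summable_nat_pow_inv.2 one_lt_two
  have hsum : Summable fun j : ℕ => (C * q : ℝ≥0) * (((j + 2 : ℕ) : ℝ≥0) ^ 2)⁻¹ :=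
    ((NNReal.summable_nat_add_iff 2).2 hinv).mul_left _
  refine ne_top_of_le_ne_top (ENNReal.tsum_coe_ne_top_iff_summable.2 hsum)
    (ENNReal.tsum_le_tsum fun j => ?_)
  have hqj : (q : ℝ≥0) ^ j ≠ 0 := by positivity
  have hle : ((n (j + 1) : ℕ) : ℝ≥0) * ((q : ℝ≥0) ^ j)⁻¹ ≤
      (C * q : ℝ≥0) * (((j + 2 : ℕ) : ℝ≥0) ^ 2)⁻¹ := by
    rw [← div_eq_mul_inv, ← div_eq_mul_inv, div_le_div_iff₀ (by positivity) (by positivity),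
      mul_assoc, ← pow_succ']
    exact_mod_cast hn (j + 1)
  have hcoe := ENNReal.coe_le_coe.2 hle
  rwa [ENNReal.coe_mul, ENNReal.coe_inv hqj, ENNReal.coe_pow, ENNReal.coe_natCast,
    ENNReal.coe_natCast] at hcoe

theorem exists_mem_nullSets_notMem_dominatedSets (hφ : IsGauge φ) (hs : s ∈ nullSequences)
    (hbs : ∀ n : ℕ+, ((n : ℕ) : ℝ≥0) * φ (s n) ≤ b) (hp : 2 ≤ p) (hX : HasAdicCodings X s p K) :
    ∃ E, (∀ α : ℝ, 1 < α → E ∈ nullSets X (gaugePow φ α)) ∧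
      E ∉ dominatedSets X (multClosure s) := by
  have hq : 0 < 4 * (p : ℕ) := mul_pos four_pos p.pos
  let n : ℕ → ℕ+ := fun j => K * dampedPow p j
  have hsparse : ∀ j, p * n j ≤ n (j + 1) := fun j =>
    (mul_left_comm p K _).trans_le (mul_le_mul_right (mul_dampedPow_le_succ p j) K)
  have hlower : ∀ j, (4 * p : ℕ) ^ j ≤ n j * (j + 1) ^ 2 := fun j => by
    rw [PNat.mul_coe, mul_assoc]
    exact (pow_le_dampedPow_mul_sq p j).trans (Nat.le_mul_of_pos_left _ K.pos)
  have hupper : ∀ j, (n j : ℕ) * (j + 1) ^ 2 ≤ (4 * K) * (4 * p) ^ j := fun j => by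
    rw [PNat.mul_coe, mul_assoc, mul_comm 4 (K : ℕ), mul_assoc]
    exact Nat.mul_le_mul_left _ (dampedPow_mul_sq_le p j)
  obtain ⟨f, hf⟩ := hX n (le_mul_of_one_le_right' one_le) hsparse
  have htop := tendsto_atTop_of_mul_le_succ hp hsparse
  exact ⟨f '' Ico 0 1,
    fun α hα => hf.image_mem_nullSets (hφ.gaugePow (one_pos.trans hα)) hq (hs.2.2.comp htop)
      (tendsto_pow_mul_gaugePow hbs (two_pow_le_of_mul_le_succ hp hsparse) hlower hα),
    hf.image_notMem_dominatedSets hq hs.1.antitone htop (tsum_mul_inv_pow_ne_top hq hupper)⟩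

theorem nullSets_ssubset_dominatedSets_ssubset (hφ : IsGauge φ) (hs : s ∈ nullSequences)
    (ha : 0 < a) (has : ∀ n : ℕ+, a ≤ ((n : ℕ) : ℝ≥0) * φ (s n))
    (hbs : ∀ n : ℕ+, ((n : ℕ) : ℝ≥0) * φ (s n) ≤ b) (hp : 2 ≤ p) (hX : HasAdicCodings X s p K) :
    nullSets X φ ⊂ dominatedSets X (multClosure s) ∧
      dominatedSets X (multClosure s) ⊂ ⋂ (α : ℝ) (_ : 1 < α), nullSets X (gaugePow φ α) := by
  obtain ⟨E, hE, hE'⟩ := exists_mem_dominatedSets_notMem_nullSets hφ hs ha has hp hX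
  obtain ⟨F, hF, hF'⟩ := exists_mem_nullSets_notMem_dominatedSets hφ hs hbs hp hX
  exact ⟨⟨nullSets_subset_dominatedSets hφ hs.2.1 ha has, fun h => hE' (h hE)⟩,
    subset_iInter₂ fun α hα => dominatedSets_subset_nullSets hφ hs hbs hα,
    fun h => hF' (h (mem_iInter₂.2 hF))⟩

end Strictness

end DominatedSets

open DominatedSets in
theorem theorem5p7_general {X : Type*} [MetricSpace X] {s : ℕ+ → ℝ≥0} (hs : s ∈ nullSequences)
    {φ : ℝ≥0 → ℝ≥0} (hφ : IsGauge φ) (hφs : Comparable φ s)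
    (hX : (∃ e : EllTwo → X, Isometry e) ∨
      (∃ e : ℝ → X, Isometry e) ∧ ∃ L < 2, IsDoublingWith L φ) :
    nullSets X φ ⊂ dominatedSets X (multClosure s) ∧
      dominatedSets X (multClosure s) ⊂ ⋂ (α : ℝ) (_ : 1 < α), nullSets X (gaugePow φ α) := by
  obtain ⟨a, b, ha, has, hbs⟩ := hφs.exists_forall hφ hs
  have hcodings : ∃ p, 2 ≤ p ∧ ∃ K, HasAdicCodings X s p K := by
    rcases hX with ⟨e, he⟩ | ⟨⟨e, he⟩, L, hL, hdouble⟩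
    · exact ⟨2, le_rfl, 1, (HasAdicCodings.ellTwo hs).of_isometry he⟩
    · obtain ⟨p, hp, K, hK⟩ := hdouble.exists_sixteen_mul_le hL hφ hs ha has hbs
      exact ⟨p, hp, K, (HasAdicCodings.real hs.2.1 hp hK).of_isometry he⟩
  obtain ⟨p, hp, K, hpK⟩ := hcodings
  exact nullSets_ssubset_dominatedSets_ssubset hφ hs ha has hbs hp hpK

theorem theorem5p7 (s : ℕ+ → ℝ≥0) (hs : s ∈ DominatedSets.nullSequences)
    (φ : ℝ≥0 → ℝ≥0) (hφ : DominatedSets.IsGauge φ) (hφs : DominatedSets.Comparable φ s) :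
    (DominatedSets.nullSets DominatedSets.EllTwo φ ⊂
        DominatedSets.dominatedSets DominatedSets.EllTwo (DominatedSets.multClosure s) ∧
      DominatedSets.dominatedSets DominatedSets.EllTwo (DominatedSets.multClosure s) ⊂
        ⋂ (α : ℝ) (_ : 1 < α),
          DominatedSets.nullSets DominatedSets.EllTwo (DominatedSets.gaugePow φ α)) ∧
    (∀ L : ℝ≥0, 0 < L → L < 2 → DominatedSets.IsDoublingWith L φ →
      DominatedSets.nullSets ℝ φ ⊂
        DominatedSets.dominatedSets ℝ (DominatedSets.multClosure s) ∧
      DominatedSets.dominatedSets ℝ (DominatedSets.multClosure s) ⊂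
        ⋂ (α : ℝ) (_ : 1 < α),
          DominatedSets.nullSets ℝ (DominatedSets.gaugePow φ α)) := by
  exact ⟨theorem5p7_general hs hφ hφs (.inl ⟨id, isometry_id⟩), fun L _ hL hdouble =>
    theorem5p7_general hs hφ hφs (.inr ⟨⟨id, isometry_id⟩, L, hL, hdouble⟩)⟩
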